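/- Let $n\ge 1$ and let $H\in\mathbb{R}^{n\times n}$ be a positive semi-definite Hankel matrix (that is, $H_{ij}$ depends only on $i+j$) with $\operatorname{rank}(H)=r$. For $0\le k\le n$ write $H(1{:}k,1{:}k)$ for the leading $k\times k$ principal submatrix of $H$; the empty matrix ($k=0$) counts as positive definite. (a) If the last column $H(:,n)$ is linearly dependent on the first $n-1$ columns, i.e. it lies in the linear span of $H(:,1),\dots,H(:,n-1)$ (for $n=1$: it is zero), then the leading $r\times r$ principal submatrix $H(1{:}r,1{:}r)$ is positive definite. (b) If $H(:,n)$ does not lie in the linear span of $H(:,1),\dots,H(:,n-1)$, then $r\ge 1$ and the leading $(r-1)\times(r-1)$ principal submatrix $H(1{:}r-1,1{:}r-1)$ is positive definite. -/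

import Mathlib

/-- A square real matrix is a Hankel matrix if its entries depend only on the sum of the (zero-based)
indices: `H i j = h (i + j)` for a generating sequence `h`. Only the values `h 0, …, h (2 * n - 2)`
matter, so this sequence stands for a generating vector of length `2 * n - 1`. -/
def IsHankel {n : ℕ} (H : Matrix (Fin n) (Fin n) ℝ) : Prop :=
  ∃ h : ℕ → ℝ, ∀ i j : Fin n, H i j = h ((i : ℕ) + (j : ℕ))

/-- The leading `k × k` principal submatrix `H(1:k, 1:k)`. -/
def leadingPrincipal {n : ℕ} (H : Matrix (Fin n) (Fin n) ℝ) (k : ℕ) (hk : k ≤ n) :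
    Matrix (Fin k) (Fin k) ℝ :=
  H.submatrix (Fin.castLE hk) (Fin.castLE hk)

/-- The last column of `H` is linearly dependent on the first `n - 1` columns, that is, it is a
linear combination of them (for `n = 1`: it is zero). -/
def LastColDependent {n : ℕ} (hn : 0 < n) (H : Matrix (Fin n) (Fin n) ℝ) : Prop :=
  H.col ⟨n - 1, Nat.sub_lt hn Nat.one_pos⟩ ∈
    Submodule.span ℝ (H.col '' {j : Fin n | (j : ℕ) < n - 1})

/-!
For a positive semidefinite matrix `M = Bᴴ B`, a combination of columns vanishes as soon as it
vanishes in the rows with the same indices, since both conditions say that the corresponding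
combination of columns of `B` is zero. In a Hankel matrix, rows `2, …, n - 1` of the columns
`0, …, n - 3` and rows `1, …, n - 2` of the columns `1, …, n - 2` form the same block, so every
linear relation among the columns `0, …, n - 3` is also a relation among their right neighbours.
Hence some endomorphism `S` sends each of the columns `0, …, n - 3` to the next one, and the first
`n - 1` columns are the orbit `c, S c, S² c, …`. If such an orbit spans a space of dimension `s`,
its first `s` vectors are independent, which makes the leading `s × s` submatrix positive definite.
Here `s` is the rank `r` in case (a) and `r - 1` in case (b).
-/

open Matrix Module Submodule

/-- The subspace spanned by the first `k` vectors `v, f v, …, f ^ (k - 1) v` of the orbit of `v`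
under the endomorphism `f`. -/
def krylovSubspace {K V : Type*} [Semiring K] [AddCommMonoid V] [Module K V]
    (f : End K V) (v : V) (k : ℕ) : Submodule K V :=
  span K ((fun i => (f ^ i) v) '' Set.Iio k)

section Krylov

variable {K V : Type*}

section Semiring

variable [Semiring K] [AddCommMonoid V] [Module K V] {f : End K V} {v : V} {k : ℕ}

theorem pow_apply_mem_krylovSubspace {i : ℕ} (hi : i < k) : (f ^ i) v ∈ krylovSubspace f v k :=
  subset_span ⟨i, hi, rfl⟩

theorem krylovSubspace_le_iff {W : Submodule K V} :
    krylovSubspace f v k ≤ W ↔ ∀ i < k, (f ^ i) v ∈ W :=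
  span_le.trans Set.forall_mem_image

theorem krylovSubspace_le_comap (hk : (f ^ k) v ∈ krylovSubspace f v k) :
    krylovSubspace f v k ≤ (krylovSubspace f v k).comap f := by
  refine krylovSubspace_le_iff.2 fun i hi => ?_
  rw [mem_comap, ← End.mul_apply, ← pow_succ']
  obtain hik | rfl : i + 1 < k ∨ i + 1 = k := Nat.lt_or_eq_of_le hi
  · exact pow_apply_mem_krylovSubspace hik
  · exact hk

theorem pow_apply_mem_krylovSubspace_of_mem (hk : (f ^ k) v ∈ krylovSubspace f v k) (i : ℕ) :
    (f ^ i) v ∈ krylovSubspace f v k := by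
  obtain hik | hki := lt_or_ge i k
  · exact pow_apply_mem_krylovSubspace hik
  · induction i, hki using Nat.le_induction with
    | base => exact hk
    | succ i _ ih =>
      rw [pow_succ', End.mul_apply]
      exact krylovSubspace_le_comap hk ih

theorem finrank_krylovSubspace_le [StrongRankCondition K] (f : End K V) (v : V) (k : ℕ) :
    finrank K (krylovSubspace f v k) ≤ k := by
  classical
  have hspan : krylovSubspace f v k =
      span K (((Finset.range k).image fun i => (f ^ i) v : Finset V) : Set V) := by
    rw [krylovSubspace, Finset.coe_image, Finset.coe_range]
  rw [hspan]
  exact (finrank_span_finset_le_card _).trans (Finset.card_image_le.trans_eq (Finset.card_range k))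

end Semiring

variable [DivisionRing K] [AddCommGroup V] [Module K V]

theorem linearIndepOn_Iio_of_forall_notMem_span {v : ℕ → V} {k : ℕ}
    (hv : ∀ j < k, v j ∉ span K (v '' Set.Iio j)) : LinearIndepOn K v (Set.Iio k) := by
  induction k with
  | zero => simp
  | succ k ih =>
    rw [← Order.succ_eq_add_one, Order.Iio_succ_eq_insert]
    exact (ih fun j hj => hv j (hj.trans k.lt_succ_self)).insert (hv k k.lt_succ_self)

theorem linearIndepOn_Iio_finrank_krylovSubspace (f : End K V) (v : V) (m : ℕ) :
    LinearIndepOn K (fun i => (f ^ i) v) (Set.Iio (finrank K (krylovSubspace f v m))) := by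
  refine linearIndepOn_Iio_of_forall_notMem_span fun j hj hmem => hj.not_ge ?_
  have : FiniteDimensional K (krylovSubspace f v j) :=
    FiniteDimensional.span_of_finite K ((Set.finite_Iio j).image _)
  have hle : krylovSubspace f v m ≤ krylovSubspace f v j :=
    krylovSubspace_le_iff.2 fun i _ => pow_apply_mem_krylovSubspace_of_mem hmem i
  exact (finrank_mono hle).trans (finrank_krylovSubspace_le f v j)

end Krylov

theorem range_eq_insert_last_image {α : Type*} {n : ℕ} (hn : 0 < n) (v : Fin n → α) :
    Set.range v = insert (v ⟨n - 1, Nat.sub_lt hn Nat.one_pos⟩) (v '' {j | (j : ℕ) < n - 1}) := by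
  rw [← Set.image_insert_eq, ← Set.image_univ]
  congr 1
  ext j
  simp only [Set.mem_univ, Set.mem_insert_iff, Set.mem_ofPred_eq, Fin.ext_iff, true_iff]
  omega

theorem exists_comp_eq_of_ker_le_ker {K V V₁ V₂ : Type*} [DivisionRing K]
    [AddCommGroup V] [Module K V] [AddCommGroup V₁] [Module K V₁] [AddCommGroup V₂] [Module K V₂]
    {f : V →ₗ[K] V₁} {g : V →ₗ[K] V₂} (h : f.ker ≤ g.ker) : ∃ S : V₁ →ₗ[K] V₂, S ∘ₗ f = g := by
  obtain ⟨s, hs⟩ := (f.ker.liftQ f le_rfl).exists_leftInverse_of_injective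
    (ker_liftQ_eq_bot _ _ _ le_rfl)
  refine ⟨f.ker.liftQ g h ∘ₗ s, LinearMap.ext fun x => ?_⟩
  have hsx : s (f x) = f.ker.mkQ x := LinearMap.congr_fun hs (f.ker.mkQ x)
  rw [LinearMap.comp_apply, LinearMap.comp_apply, hsx, mkQ_apply, liftQ_apply]

section PosSemidef

open scoped ComplexOrder

variable {𝕜 m n : Type*} [RCLike 𝕜] [Finite n] {M : Matrix n n 𝕜}

theorem submatrix_id_mulVec_eq_zero_iff_of_posSemidef [Fintype m] (hM : M.PosSemidef) (e : m → n)
    (x : m → 𝕜) : M.submatrix id e *ᵥ x = 0 ↔ M.submatrix e e *ᵥ x = 0 := by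
  refine ⟨fun h => funext fun i => congrFun h (e i), fun h => ?_⟩
  classical
  have := Fintype.ofFinite n
  obtain ⟨B, rfl⟩ : ∃ B : Matrix n n 𝕜, M = Bᴴ * B := by
    open scoped MatrixOrder in exact CStarAlgebra.nonneg_iff_eq_star_mul_self.mp hM.nonneg
  have hgram : (Bᴴ * B).submatrix e e = (B.submatrix id e)ᴴ * B.submatrix id e := rfl
  have hB : B.submatrix id e *ᵥ x = 0 := by
    rwa [hgram, conjTranspose_mul_self_mulVec_eq_zero] at h
  have hcols : (Bᴴ * B).submatrix id e = Bᴴ * B.submatrix id e := rfl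
  rw [hcols, ← mulVec_mulVec, hB, mulVec_zero]

theorem posDef_submatrix_of_linearIndependent_col [Finite m] (hM : M.PosSemidef) {e : m → n}
    (he : LinearIndependent 𝕜 fun i => M.col (e i)) : (M.submatrix e e).PosDef := by
  classical
  have := Fintype.ofFinite m
  have hinj : Function.Injective (M.submatrix id e).mulVec := mulVec_injective_iff.2 he
  rw [(hM.submatrix e).posDef_iff_isUnit, ← mulVec_injective_iff_isUnit, ← coe_mulVecLin,
    injective_iff_map_eq_zero]
  intro x hx
  have hx' : M.submatrix id e *ᵥ x = 0 :=
    (submatrix_id_mulVec_eq_zero_iff_of_posSemidef hM e x).2 hx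
  exact hinj (hx'.trans (mulVec_zero _).symm)

end PosSemidef

namespace IsHankel

variable {n : ℕ} {H : Matrix (Fin n) (Fin n) ℝ}

theorem exists_apply_col_eq_col_succ (hH : IsHankel H) (hpsd : H.PosSemidef) :
    ∃ S : End ℝ (Fin n → ℝ), ∀ j (hj : j + 2 < n),
      S (H.col ⟨j, by omega⟩) = H.col ⟨j + 1, by omega⟩ := by
  obtain ⟨h, hh⟩ := hH
  let e (k : Fin 3) (i : Fin (n - 2)) : Fin n := ⟨i + k, by omega⟩
  have hblock : H.submatrix (e 2) (e 0) = H.submatrix (e 1) (e 1) := by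
    ext i j
    calc H (e 2 i) (e 0 j) = h (i + 2 + (j + 0)) := hh _ _
      _ = h (i + 1 + (j + 1)) := congrArg h (by omega)
      _ = H (e 1 i) (e 1 j) := (hh (e 1 i) (e 1 j)).symm
  have hker : (H.submatrix id (e 0)).mulVecLin.ker ≤ (H.submatrix id (e 1)).mulVecLin.ker := by
    intro x hx
    rw [LinearMap.mem_ker, mulVecLin_apply] at hx ⊢
    rw [submatrix_id_mulVec_eq_zero_iff_of_posSemidef hpsd, ← hblock]
    exact funext fun i => congrFun hx (e 2 i)
  obtain ⟨S, hS⟩ := exists_comp_eq_of_ker_le_ker hker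
  refine ⟨S, fun j hj => ?_⟩
  have hSj := LinearMap.congr_fun hS (Pi.single ⟨j, by omega⟩ 1)
  rw [LinearMap.comp_apply, mulVecLin_apply, mulVecLin_apply, mulVec_single_one,
    mulVec_single_one] at hSj
  exact hSj

theorem exists_col_eq_pow_apply (hH : IsHankel H) (hpsd : H.PosSemidef) (hn : 0 < n) :
    ∃ S : End ℝ (Fin n → ℝ), ∀ j : Fin n, (j : ℕ) < n - 1 →
      H.col j = (S ^ (j : ℕ)) (H.col ⟨0, hn⟩) := by
  obtain ⟨S, hS⟩ := hH.exists_apply_col_eq_col_succ hpsd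
  refine ⟨S, fun ⟨j, hjn⟩ hj => ?_⟩
  induction j with
  | zero => rfl
  | succ j ih =>
    have hj' : j + 1 < n - 1 := hj
    have ih' := ih (by omega) (Nat.lt_of_succ_lt hj')
    rw [pow_succ', End.mul_apply, ← ih', hS j (by omega)]

theorem posDef_leadingPrincipal_finrank (hH : IsHankel H) (hpsd : H.PosSemidef) (hn : 0 < n) :
    ∃ hs : finrank ℝ (span ℝ (H.col '' {j | (j : ℕ) < n - 1})) ≤ n,
      (leadingPrincipal H _ hs).PosDef := by
  obtain ⟨S, hS⟩ := hH.exists_col_eq_pow_apply hpsd hn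
  have hkrylov : span ℝ (H.col '' {j | (j : ℕ) < n - 1}) =
      krylovSubspace S (H.col ⟨0, hn⟩) (n - 1) := by
    rw [krylovSubspace]
    congr 1
    ext x
    constructor
    · rintro ⟨j, hj, rfl⟩
      exact ⟨j, hj, (hS j hj).symm⟩
    · rintro ⟨i, hi, rfl⟩
      exact ⟨⟨i, hi.trans_le (n.sub_le 1)⟩, hi, hS _ hi⟩
  rw [hkrylov]
  have hs := finrank_krylovSubspace_le S (H.col ⟨0, hn⟩) (n - 1)
  refine ⟨hs.trans (n.sub_le 1), posDef_submatrix_of_linearIndependent_col hpsd ?_⟩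
  refine (linearIndependent_equiv' Fin.equivSubtype ?_).2
    (linearIndepOn_Iio_finrank_krylovSubspace S (H.col ⟨0, hn⟩) (n - 1))
  exact funext fun i => (hS (Fin.castLE _ i) (i.isLt.trans_le hs)).symm

end IsHankel

theorem mainTheorem6 (n r : ℕ) (hn : 0 < n) (H : Matrix (Fin n) (Fin n) ℝ)
    (hHankel : IsHankel H) (hpsd : H.PosSemidef) (hrank : H.rank = r) :
    (LastColDependent hn H →
      ∃ hrn : r ≤ n, (leadingPrincipal H r hrn).PosDef) ∧
    (¬ LastColDependent hn H →
      1 ≤ r ∧ ∃ hrn : r - 1 ≤ n, (leadingPrincipal H (r - 1) hrn).PosDef) := by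
  obtain ⟨hs, hposDef⟩ := hHankel.posDef_leadingPrincipal_finrank hpsd hn
  rw [rank_eq_finrank_span_cols, range_eq_insert_last_image hn] at hrank
  constructor
  · intro hdep
    rw [span_insert_eq_span hdep] at hrank
    subst hrank
    exact ⟨hs, hposDef⟩
  · intro hindep
    rw [span_insert, sup_comm, finrank_sup_span_singleton hindep] at hrank
    subst hrank
    exact ⟨Nat.le_add_left 1 _, hs, hposDef⟩
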